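/- Conventions. A class of groups $\mathcal{C}$ is any collection of groups. A group $G$ is *residually $\mathcal{C}$* if for every $g\in G\setminus\{1\}$ there is a homomorphism $\phi:G\to H$ with $H\in\mathcal{C}$ and $\phi(g)\neq 1$; it is *fully residually $\mathcal{C}$* if for every finite set of nontrivial elements $g_1,\dots,g_n\in G$ there is a homomorphism $\phi:G\to H$ with $H\in\mathcal{C}$ and $\phi(g_i)\ne 1$ for all $i$. A group $G$ is - *CSA* if every maximal abelian subgroup $M$ is malnormal, i.e. $gMg^{-1}\cap M=1$ for all $g\in G\setminus M$; - *CT* if $[x,y]=1$ and $[y,z]=1$ imply $[x,z]=1$ for all nontrivial $x,y,z\in G$; - *PC* if $[x,y^n]=1$ and $y^n\neq 1$ imply $[x,y]=1$ for all $x,y\in G$, $n\in\mathbb{Z}$; - *PT* if the relation "there are $x\in G\setminus\{1\}$ and $n,m\in\mathbb{Z}$ with $a=x^n$, $b=x^m$" is transitive on the nontrivial elements $a,b$ of $G$; - *ALC* if every abelian subgroup is locally cyclic, i.e. all of its finitely generated subgroups are cyclic; - *BP* if for every $k\ge 1$ and all nontrivial $u_1,\dots,u_k\in G$ with $[u_i,u_{i+1}]\neq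 1$ for $1\le i<k$ there is $n\in\mathbb{N}$ such that $u_1^{\alpha_1}\cdots u_k^{\alpha_k}\ne 1$ for all integers $\alpha_1,\dots,\alpha_k\ge n$; - *universally $\mathcal{C}$* if it satisfies the universal theory of the countable nonabelian groups in $\mathcal{C}$: every universal first-order sentence of the language of groups that is true in each countable nonabelian group in $\mathcal{C}$ is true in $G$. **Corollary 5.1.** Let $\mathcal{C}$ be a class of finitely presented groups such that each nonabelian group in $\mathcal{C}$ is CSA, ALC and BP. Let $G$ be a nonabelian, residually $\mathcal{C}$ group which is ALC and has trivial center. Then the following are equivalent: 1. $G$ is fully residually $\mathcal{C}$; 2. $G$ is CSA; 3. $G$ is CT; 4. $G$ is PC; 5. $G$ is PT; 6. $G$ is universally $\mathcal{C}$. -/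

import Mathlib

universe u v

namespace GroupClass

/-- A group is nonabelian if some two elements do not commute. -/
def Nonabelian (G : Type u) [Group G] : Prop :=
  ∃ x y : G, ¬ Commute x y

/-! ### Residual properties

A class of groups is a predicate `C` on groups (of a fixed universe). -/

/-- `G` is residually `C`: every nontrivial element survives in some homomorphism to a group
in `C`. -/
def IsResidually (C : ∀ (H : Type u) [Group H], Prop) (G : Type v) [Group G] : Prop :=
  ∀ g : G, g ≠ 1 → ∃ (H : Type u) (_ : Group H) (f : G →* H), C H ∧ f g ≠ 1

/-- `G` is fully residually `C`: any finitely many nontrivial elements survive simultaneously in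
some homomorphism to a group in `C`. -/
def IsFullyResidually (C : ∀ (H : Type u) [Group H], Prop) (G : Type v) [Group G] : Prop :=
  ∀ S : Finset G, (∀ g ∈ S, g ≠ 1) →
    ∃ (H : Type u) (_ : Group H) (f : G →* H), C H ∧ ∀ g ∈ S, f g ≠ 1

/-! ### Properties of a group -/

/-- A subgroup `M` is malnormal if `g M g⁻¹ ∩ M = 1` for every `g ∉ M`. -/
def IsMalnormal {G : Type u} [Group G] (M : Subgroup G) : Prop :=
  ∀ g : G, g ∉ M → ∀ x : G, x ∈ M → g * x * g⁻¹ ∈ M → x = 1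

/-- CSA: all maximal abelian subgroups are malnormal. -/
def IsCSA (G : Type u) [Group G] : Prop :=
  ∀ M : Subgroup G, Maximal (fun K : Subgroup G => IsMulCommutative K) M → IsMalnormal M

/-- CT: commutativity is transitive on the nontrivial elements. -/
def IsCT (G : Type u) [Group G] : Prop :=
  ∀ x y z : G, x ≠ 1 → y ≠ 1 → z ≠ 1 → Commute x y → Commute y z → Commute x z

/-- PC (power commutative): if `x` commutes with a nontrivial power of `y`, then `x` commutes
with `y`. -/
def IsPC (G : Type u) [Group G] : Prop :=
  ∀ (x y : G) (n : ℤ), y ^ n ≠ 1 → Commute x (y ^ n) → Commute x y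

/-- Two elements are in power relation if they are both powers of one nontrivial element. -/
def PowerRelated {G : Type u} [Group G] (a b : G) : Prop :=
  ∃ x : G, x ≠ 1 ∧ ∃ n m : ℤ, a = x ^ n ∧ b = x ^ m

/-- PT (power transitive): the power relation is transitive on the nontrivial elements. -/
def IsPT (G : Type u) [Group G] : Prop :=
  ∀ a b c : G, a ≠ 1 → b ≠ 1 → c ≠ 1 → PowerRelated a b → PowerRelated b c → PowerRelated a c

/-- A group is locally cyclic if each of its finitely generated subgroups is cyclic. -/
def IsLocallyCyclic (A : Type u) [Group A] : Prop :=
  ∀ B : Subgroup A, B.FG → IsCyclic B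

/-- ALC: every abelian subgroup is locally cyclic. -/
def IsALC (G : Type u) [Group G] : Prop :=
  ∀ A : Subgroup G, IsMulCommutative A → IsLocallyCyclic A

/-- A sequence `u₀, …, u_k` (of length `k + 1 ≥ 1`) is generic if neighbouring elements do not
commute. -/
def IsGeneric {G : Type u} [Group G] {k : ℕ} (w : Fin (k + 1) → G) : Prop :=
  ∀ i : Fin k, ¬ Commute (w i.castSucc) (w i.succ)

/-- A sequence `u₀, …, u_k` is independent if there is `n` such that the ordered product
`u₀ ^ α₀ ⋯ u_k ^ α_k` is nontrivial for all exponents `α₀, …, α_k ≥ n`. -/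
def IsIndependent {G : Type u} [Group G] {k : ℕ} (w : Fin (k + 1) → G) : Prop :=
  ∃ n : ℕ, ∀ α : Fin (k + 1) → ℕ, (∀ i, n ≤ α i) →
    (List.ofFn fun i => w i ^ α i).prod ≠ 1

/-- BP (big powers condition): every generic sequence of nontrivial elements is independent. -/
def IsBP (G : Type u) [Group G] : Prop :=
  ∀ (k : ℕ) (w : Fin (k + 1) → G), (∀ i, w i ≠ 1) → IsGeneric w → IsIndependent w

/-! ### The first-order language of groups and universal theories -/

/-- The function symbols of the language of groups, by arity. -/
inductive GroupFunc : ℕ → Type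
  | one : GroupFunc 0
  | inv : GroupFunc 1
  | mul : GroupFunc 2

/-- The first-order language of groups: `1`, `⁻¹`, `*`, with no relation symbol but equality. -/
def groupLanguage : FirstOrder.Language where
  Functions := GroupFunc
  Relations := fun _ => Empty

/-- Every group is a structure for the language of groups, in the obvious way. -/
instance groupStructure (G : Type u) [Group G] : groupLanguage.Structure G where
  funMap := fun {_} f => match f with
    | GroupFunc.one => fun _ => 1
    | GroupFunc.inv => fun x => (x 0)⁻¹
    | GroupFunc.mul => fun x => x 0 * x 1
  RelMap := fun r => r.elim

/-- `G` is universally `C`: it satisfies the universal theory of the countable nonabelian groups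
in `C`, i.e. every universal sentence of the language of groups that holds in each countable
nonabelian group in `C` holds in `G`. -/
def IsUniversally (C : ∀ (H : Type u) [Group H], Prop) (G : Type v) [Group G] : Prop :=
  ∀ φ : groupLanguage.Sentence, FirstOrder.Language.BoundedFormula.IsUniversal φ →
    (∀ (H : Type u) [Group H], C H → Countable H → Nonabelian H →
      FirstOrder.Language.Sentence.Realize H φ) →
    FirstOrder.Language.Sentence.Realize G φ

end GroupClass

/-! The core is that CT implies fully residually `C`. In a centerless CT group that is residually
`C`, any nontrivial `a` fails to commute with some conjugate of any nontrivial `b`. Iterated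
commutators thus fold a finite set into one nontrivial `w` that dies whenever a member dies, and
residuality at `w` suffices. Conversely, CSA is CT plus "commuting with one's own conjugate forces
commuting with the conjugator"; a failure of either involves finitely many elements and survives in
a nonabelian image. ALC turns commuting into being powers of a common element, which closes CT, PC,
PT into a cycle. For universal theories, a counterexample to a universal sentence is also a finite
configuration, and CT is itself a universal sentence. -/

namespace GroupClass

open FirstOrder FirstOrder.Language
open scoped commutatorElement

/-! ### Implications among CSA, CT, PC and PT inside one group. -/

section Commutation

variable {G : Type u} [Group G]

/-- A set of pairwise commuting elements lies in a maximal abelian subgroup. -/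
theorem exists_maximal_abelian_of_commute {s : Set G} (hs : ∀ a ∈ s, ∀ b ∈ s, a * b = b * a) :
    ∃ M : Subgroup G, Maximal (fun K : Subgroup G => IsMulCommutative K) M ∧ s ⊆ M := by
  obtain ⟨M, hle, hM⟩ := zorn_le_nonempty₀ {K : Subgroup G | IsMulCommutative K}
    (fun c hc hchain y hy => by
      refine ⟨sSup c, ?_, fun z hz => le_sSup hz⟩
      have hdir : DirectedOn (· ≤ ·) c := hchain.directedOn
      simp only [Set.mem_ofPred_eq, isMulCommutative_iff, Subtype.forall, MulMemClass.mk_mul_mk,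
        Subtype.mk.injEq]
      intro a ha b hb
      rw [Subgroup.mem_sSup_of_directedOn ⟨y, hy⟩ hdir] at ha hb
      obtain ⟨K, hK, haK⟩ := ha
      obtain ⟨L, hL, hbL⟩ := hb
      obtain ⟨N, hN, hKN, hLN⟩ := hdir K hK L hL
      have : IsMulCommutative N := hc hN
      exact setLike_mul_comm (hKN haK) (hLN hbL))
    (Subgroup.closure s) (Subgroup.isMulCommutative_closure hs)
  exact ⟨M, hM, Subgroup.subset_closure.trans hle⟩

theorem exists_maximal_abelian_of_commute_pair {x y : G} (h : Commute x y) :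
    ∃ M : Subgroup G, Maximal (fun K : Subgroup G => IsMulCommutative K) M ∧ x ∈ M ∧ y ∈ M := by
  obtain ⟨M, hM, hs⟩ := exists_maximal_abelian_of_commute (s := {x, y}) (by
    rintro a (rfl | rfl) b (rfl | rfl)
    exacts [rfl, h.eq, h.eq.symm, rfl])
  exact ⟨M, hM, hs (by simp), hs (by simp)⟩

/-- In a CSA group an element commuting with a conjugate of itself commutes with the conjugator. -/
theorem IsCSA.commute_of_commute_conj (h : IsCSA G) {x g : G} (hx : x ≠ 1)
    (hc : Commute x (g * x * g⁻¹)) : Commute x g := by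
  obtain ⟨M, hM, hxM, hgM⟩ := exists_maximal_abelian_of_commute_pair hc
  by_cases hg : g ∈ M
  · have := hM.prop
    exact setLike_mul_comm hxM hg
  · exact absurd (h M hM g hg x hxM hgM) hx

/-- Since `z` fixes `y` by conjugation, malnormality of a maximal abelian `M` containing `x` and `y`
forces `z` into `M`. -/
theorem IsCSA.isCT (h : IsCSA G) : IsCT G := by
  intro x y z _ hy _ hxy hyz
  obtain ⟨M, hM, hxM, hyM⟩ := exists_maximal_abelian_of_commute_pair hxy
  have hz : z ∈ M := by
    by_contra hz
    refine hy (h M hM z hz y hyM ?_)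
    rwa [← hyz.eq, mul_inv_cancel_right]
  have := hM.prop
  exact setLike_mul_comm hxM hz

/-- A `g` violating malnormality at `x` commutes with `x`, hence by CT with all of `M`, so
maximality puts `g` in `M`. -/
theorem IsCT.isCSA (h : IsCT G)
    (hconj : ∀ x g : G, x ≠ 1 → Commute x (g * x * g⁻¹) → Commute x g) : IsCSA G := by
  intro M hM g hg x hx hgx
  by_contra hx1
  have hMc := hM.prop
  have hxg : Commute x g := hconj x g hx1 (setLike_mul_comm hx hgx)
  have hg1 : g ≠ 1 := fun h1 => hg (h1 ▸ M.one_mem)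
  have hgM : ∀ m ∈ M, m * g = g * m := fun m hm => by
    by_cases hm1 : m = 1
    · simp [hm1]
    · exact h m x g hm1 hx1 hg1 (setLike_mul_comm hm hx) hxg
  have hK : IsMulCommutative (Subgroup.closure (insert g (M : Set G))) := by
    refine Subgroup.isMulCommutative_closure ?_
    rintro a (rfl | ha) b (rfl | hb)
    · rfl
    · exact (hgM b hb).symm
    · exact hgM a ha
    · exact setLike_mul_comm ha hb
  exact hg (hM.le_of_ge hK (fun m hm => Subgroup.subset_closure (Set.mem_insert_of_mem _ hm))
    (Subgroup.subset_closure (Set.mem_insert _ _)))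

theorem IsCT.isPC (h : IsCT G) : IsPC G := by
  intro x y n hn hc
  by_cases hx : x = 1
  · simp [hx]
  have hy : y ≠ 1 := fun hy => hn (by simp [hy])
  exact h x (y ^ n) y hx hn hy hc ((Commute.refl y).zpow_left n)

theorem PowerRelated.commute {a b : G} (h : PowerRelated a b) : Commute a b := by
  obtain ⟨x, -, n, m, rfl, rfl⟩ := h
  exact (Commute.refl x).zpow_zpow n m

theorem IsALC.powerRelated_of_commute (h : IsALC G) {x y : G} (hx : x ≠ 1) (hc : Commute x y) :
    PowerRelated x y := by
  obtain ⟨M, hM, hxM, hyM⟩ := exists_maximal_abelian_of_commute_pair hc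
  have hcyc := h M hM.prop (Subgroup.closure {⟨x, hxM⟩, ⟨y, hyM⟩})
    ((Subgroup.fg_iff _).2 ⟨_, rfl, by simp⟩)
  obtain ⟨z, hz⟩ := hcyc.exists_generator
  obtain ⟨n, hn⟩ := hz ⟨⟨x, hxM⟩, Subgroup.subset_closure (by simp)⟩
  obtain ⟨m, hm⟩ := hz ⟨⟨y, hyM⟩, Subgroup.subset_closure (by simp)⟩
  have hn' : ((z : M) : G) ^ n = x := congrArg (fun w => ((w.1 : M) : G)) hn
  have hm' : ((z : M) : G) ^ m = y := congrArg (fun w => ((w.1 : M) : G)) hm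
  refine ⟨z, fun h1 => hx ?_, n, m, hn'.symm, hm'.symm⟩
  rw [← hn', h1, one_zpow]

theorem IsPC.isPT (hALC : IsALC G) (h : IsPC G) : IsPT G := by
  rintro a b c ha hb hc ⟨x, hx, n, m, rfl, rfl⟩ ⟨y, hy, p, q, hbp, rfl⟩
  -- The middle element is a nontrivial power of both roots, so PC makes the roots commute.
  have hxy : Commute x y :=
    h x y p (hbp ▸ hb) (hbp ▸ (Commute.refl x).zpow_right m)
  exact hALC.powerRelated_of_commute ha (hxy.zpow_zpow n q)

theorem IsPT.isCT (hALC : IsALC G) (h : IsPT G) : IsCT G := fun x y z hx hy hz hxy hyz =>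
  (h x y z hx hy hz (hALC.powerRelated_of_commute hx hxy)
    (hALC.powerRelated_of_commute hy hyz)).commute

end Commutation

/-! ### CT and full residuality. -/

section Residual

variable {C : ∀ (H : Type u) [Group H], Prop} {G : Type v} [Group G]

theorem IsFullyResidually.isCSA (hC : ∀ (H : Type u) [Group H], C H → Nonabelian H → IsCSA H)
    (h : IsFullyResidually C G) : IsCSA G := by
  classical
  refine IsCT.isCSA (fun x y z hx hy hz hxy hyz => ?_) (fun x g hx hc => ?_)
  · by_contra hxz
    -- Survival of the commutator both preserves the failure of CT and makes `H` nonabelian.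
    obtain ⟨H, _, f, hH, hf⟩ := h {x, y, z, ⁅x, z⁆} (by
      simpa [hx, hy, hz, commutatorElement_eq_one_iff_commute] using hxz)
    simp only [Finset.mem_insert, Finset.mem_singleton, forall_eq_or_imp, forall_eq,
      map_commutatorElement, ne_eq, commutatorElement_eq_one_iff_commute] at hf
    obtain ⟨hfx, hfy, hfz, hfc⟩ := hf
    exact hfc ((hC H hH ⟨_, _, hfc⟩).isCT _ _ _ hfx hfy hfz (hxy.map f) (hyz.map f))
  · by_contra hxg
    obtain ⟨H, _, f, hH, hf⟩ := h {x, ⁅x, g⁆} (by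
      simpa [hx, commutatorElement_eq_one_iff_commute] using hxg)
    simp only [Finset.mem_insert, Finset.mem_singleton, forall_eq_or_imp, forall_eq,
      map_commutatorElement, ne_eq, commutatorElement_eq_one_iff_commute] at hf
    obtain ⟨hfx, hfc⟩ := hf
    exact hfc ((hC H hH ⟨_, _, hfc⟩).commute_of_commute_conj hfx (by simpa using hc.map f))

/-- In a centerless CT group which is residually in a class of groups whose nonabelian members are
CSA, no nontrivial element commutes with all conjugates of another one. -/
theorem IsCT.exists_not_commute_conj
    (hC : ∀ (H : Type u) [Group H], C H → Nonabelian H → IsCSA H)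
    (hres : IsResidually C G) (hcenter : Subgroup.center G = ⊥) (h : IsCT G) {a b : G}
    (ha : a ≠ 1) (hb : b ≠ 1) : ∃ t : G, ¬ Commute a (t * b * t⁻¹) := by
  by_contra! hall
  -- CT through `a`, which commutes with every conjugate of `b`.
  have hconj : ∀ t : G, Commute b (t * b * t⁻¹) := fun t =>
    h b a _ hb ha (by simpa using hb) (by simpa using (hall 1).symm) (hall t)
  obtain ⟨g, hg⟩ : ∃ g, ¬ Commute b g := by
    by_contra! hbc
    have : b ∈ Subgroup.center G := Subgroup.mem_center_iff.2 fun g => (hbc g).eq.symm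
    rw [hcenter, Subgroup.mem_bot] at this
    exact hb this
  obtain ⟨H, _, f, hH, hf⟩ := hres ⁅b, g⁆ (by rwa [ne_eq, commutatorElement_eq_one_iff_commute])
  rw [map_commutatorElement, ne_eq, commutatorElement_eq_one_iff_commute] at hf
  refine hf ((hC H hH ⟨_, _, hf⟩).commute_of_commute_conj (fun h1 => hf ?_)
    (by simpa using (hconj g).map f))
  rw [h1]
  exact Commute.one_left _

theorem IsCT.isFullyResidually [Nontrivial G]
    (hC : ∀ (H : Type u) [Group H], C H → Nonabelian H → IsCSA H)
    (hres : IsResidually C G) (hcenter : Subgroup.center G = ⊥) (h : IsCT G) :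
    IsFullyResidually C G := by
  classical
  intro S hS
  obtain ⟨w, hw, hwS⟩ : ∃ w : G, w ≠ 1 ∧
      ∀ (H : Type u) [Group H] (f : G →* H), f w ≠ 1 → ∀ g ∈ S, f g ≠ 1 := by
    induction S using Finset.induction_on with
    | empty =>
      obtain ⟨w, hw⟩ := exists_ne (1 : G)
      exact ⟨w, hw, by simp⟩
    | insert a S _ ih =>
      obtain ⟨w, hw, hwS⟩ := ih fun g hg => hS g (Finset.mem_insert_of_mem hg)
      obtain ⟨t, ht⟩ :=
        h.exists_not_commute_conj hC hres hcenter (hS a (Finset.mem_insert_self a S)) hw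
      refine ⟨⁅a, t * w * t⁻¹⁆, by rwa [ne_eq, commutatorElement_eq_one_iff_commute], ?_⟩
      intro H _ f hf g hg
      rw [map_commutatorElement] at hf
      rcases Finset.mem_insert.1 hg with rfl | hg
      · intro h1
        exact hf (by simp [h1])
      · exact hwS H f (fun h1 => hf (by simp [h1])) g hg
  obtain ⟨H, hHg, f, hH, hf⟩ := hres w hw
  exact ⟨H, hHg, f, hH, hwS H f hf⟩

end Residual

/-! ### Transfer of universal sentences. -/

section Universal

/-- A group homomorphism as a homomorphism of structures for the language of groups. -/
def languageHom {G : Type v} {H : Type u} [Group G] [Group H] (f : G →* H) :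
    G →[groupLanguage] H where
  toFun := f
  map_fun' := fun φ x => by
    cases φ
    · exact map_one f
    · exact map_inv f _
    · exact map_mul f _ _
  map_rel' := fun r => r.elim

theorem realize_term_map {G : Type v} {H : Type u} [Group G] [Group H] (f : G →* H) {α : Type*}
    (t : groupLanguage.Term α) (v : α → G) :
    t.realize (f ∘ v) = f (t.realize v) :=
  HomClass.realize_term (languageHom f)

/-- The truth value of a quantifier-free formula at a tuple is preserved by every homomorphism that
does not kill any element of a suitable finite set of nontrivial elements. -/
theorem exists_finset_realize_iff_of_isQF {G : Type v} [Group G] {α : Type*} {n : ℕ}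
    {φ : groupLanguage.BoundedFormula α n} (hφ : φ.IsQF) (a : α → G) (xs : Fin n → G) :
    ∃ S : Finset G, (∀ g ∈ S, g ≠ 1) ∧ ∀ (H : Type u) [Group H] (f : G →* H),
      (∀ g ∈ S, f g ≠ 1) → (φ.Realize (f ∘ a) (f ∘ xs) ↔ φ.Realize a xs) := by
  classical
  induction hφ with
  | falsum => exact ⟨∅, by simp, fun _ _ _ _ => Iff.rfl⟩
  | of_isAtomic h =>
    cases h with
    | equal t₁ t₂ =>
      have key : ∀ (H : Type u) [Group H] (f : G →* H),
          (t₁.bdEqual t₂).Realize (f ∘ a) (f ∘ xs) ↔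
            f (t₁.realize (Sum.elim a xs)) = f (t₂.realize (Sum.elim a xs)) := fun H _ f => by
        rw [BoundedFormula.realize_bdEqual, ← Sum.comp_elim, realize_term_map, realize_term_map]
      by_cases heq : t₁.realize (Sum.elim a xs) = t₂.realize (Sum.elim a xs)
      · refine ⟨∅, by simp, fun H _ f _ => ?_⟩
        simp [key, heq]
      -- Equalities pass to every image; an inequality passes once the quotient of its sides
      -- survives.
      · refine ⟨{t₁.realize (Sum.elim a xs) / t₂.realize (Sum.elim a xs)},
          by simpa [div_eq_one] using heq, fun H _ f hf => ?_⟩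
        simpa [key, heq, div_eq_one] using hf
    | rel R ts => exact R.elim
  | imp _ _ ih₁ ih₂ =>
    obtain ⟨S₁, h₁, hS₁⟩ := ih₁
    obtain ⟨S₂, h₂, hS₂⟩ := ih₂
    refine ⟨S₁ ∪ S₂, fun g hg => (Finset.mem_union.1 hg).elim (h₁ g) (h₂ g), fun H _ f hf => ?_⟩
    rw [BoundedFormula.realize_imp, BoundedFormula.realize_imp,
      hS₁ H f fun g hg => hf g (Finset.mem_union_left _ hg),
      hS₂ H f fun g hg => hf g (Finset.mem_union_right _ hg)]

/-- The failure of a universal formula at a tuple is preserved by every homomorphism that does not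
kill any element of a suitable finite set of nontrivial elements. -/
theorem exists_finset_not_realize_of_isUniversal {G : Type v} [Group G] {α : Type*} {n : ℕ}
    {φ : groupLanguage.BoundedFormula α n} (hφ : φ.IsUniversal) (a : α → G) (xs : Fin n → G)
    (hnot : ¬ φ.Realize a xs) :
    ∃ S : Finset G, (∀ g ∈ S, g ≠ 1) ∧ ∀ (H : Type u) [Group H] (f : G →* H),
      (∀ g ∈ S, f g ≠ 1) → ¬ φ.Realize (f ∘ a) (f ∘ xs) := by
  induction hφ with
  | of_isQF h =>
    obtain ⟨S, hS, hiff⟩ := exists_finset_realize_iff_of_isQF h a xs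
    exact ⟨S, hS, fun H _ f hf => by rwa [hiff H f hf]⟩
  | all _ ih =>
    rw [BoundedFormula.realize_all, not_forall] at hnot
    obtain ⟨g, hg⟩ := hnot
    obtain ⟨S, hS, hfail⟩ := ih (Fin.snoc xs g) hg
    refine ⟨S, hS, fun H _ f hf hall => hfail H f hf ?_⟩
    rw [Fin.comp_snoc]
    exact hall (f g)

theorem IsFullyResidually.isUniversally {C : ∀ (H : Type u) [Group H], Prop}
    (hcount : ∀ (H : Type u) [Group H], C H → Countable H) {G : Type v} [Group G]
    (hG : Nonabelian G) (h : IsFullyResidually C G) : IsUniversally C G := by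
  classical
  intro φ hφ hall
  by_contra hnot
  obtain ⟨x, y, hxy⟩ := hG
  obtain ⟨S, hS, hfail⟩ := exists_finset_not_realize_of_isUniversal hφ default default hnot
  -- The extra commutator keeps `H` nonabelian, so that the sentence holds there.
  obtain ⟨H, _, f, hH, hf⟩ := h (insert ⁅x, y⁆ S) (by
    simpa [commutatorElement_eq_one_iff_commute, hxy] using hS)
  refine hfail H f (fun g hg => hf g (Finset.mem_insert_of_mem hg)) ?_
  have hfxy := hf _ (Finset.mem_insert_self _ _)
  rw [map_commutatorElement, ne_eq, commutatorElement_eq_one_iff_commute] at hfxy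
  have hr := hall H hH (hcount H hH) ⟨_, _, hfxy⟩
  rwa [Sentence.Realize, Formula.Realize, ← Subsingleton.elim (f ∘ default) default,
    ← Subsingleton.elim (f ∘ default) default] at hr

/-- The term `s * t` in the language of groups. -/
def mulTerm {α : Type*} (s t : groupLanguage.Term α) : groupLanguage.Term α :=
  Functions.apply₂ (L := groupLanguage) GroupFunc.mul s t

theorem realize_mulTerm {G : Type u} [Group G] {α : Type*} (s t : groupLanguage.Term α)
    (a : α → G) : (mulTerm s t).realize a = s.realize a * t.realize a :=
  rfl

/-- The formula stating that two terms commute. -/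
def commuteFormula {α : Type*} {n : ℕ} (s t : groupLanguage.Term (α ⊕ Fin n)) :
    groupLanguage.BoundedFormula α n :=
  (mulTerm s t).bdEqual (mulTerm t s)

/-- The sentence stating that commutation is transitive on nontrivial elements. -/
def ctSentence : groupLanguage.Sentence :=
  let x : groupLanguage.Term (Empty ⊕ Fin 3) := Term.var (Sum.inr 0)
  let y : groupLanguage.Term (Empty ⊕ Fin 3) := Term.var (Sum.inr 1)
  let z : groupLanguage.Term (Empty ⊕ Fin 3) := Term.var (Sum.inr 2)
  -- Here `y * y ≠ y` encodes `y ≠ 1`; trivial `x` or `z` commute with everything and need no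
  -- exclusion.
  ((((mulTerm y y).bdEqual y).imp BoundedFormula.falsum).imp
    ((commuteFormula x y).imp ((commuteFormula y z).imp (commuteFormula x z)))).all.all.all

theorem isUniversal_ctSentence : BoundedFormula.IsUniversal ctSentence := by
  have atom : ∀ s t : groupLanguage.Term (Empty ⊕ Fin 3), (s.bdEqual t).IsQF := fun s t =>
    .of_isAtomic (.equal s t)
  exact .all (.all (.all (.of_isQF
    (((atom _ _).imp .falsum).imp ((atom _ _).imp ((atom _ _).imp (atom _ _)))))))

theorem realize_ctSentence {G : Type u} [Group G] : G ⊨ ctSentence ↔ IsCT G := by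
  have key : G ⊨ ctSentence ↔ ∀ x y z : G, (y * y = y → False) → x * y = y * x →
      y * z = z * y → x * z = z * x := Iff.rfl
  rw [key]
  refine ⟨fun h x y z _ hy _ hxy hyz => h x y z (by simpa using hy) hxy.eq hyz.eq,
    fun h x y z hy hxy hyz => ?_⟩
  by_cases hx : x = 1
  · simp [hx]
  by_cases hz : z = 1
  · simp [hz]
  exact h x y z hx (by simpa using hy) hz hxy hyz

theorem IsUniversally.isCT {C : ∀ (H : Type u) [Group H], Prop}
    (hC : ∀ (H : Type u) [Group H], C H → Nonabelian H → IsCT H) {G : Type v} [Group G]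
    (h : IsUniversally C G) : IsCT G :=
  realize_ctSentence.1 <| h _ isUniversal_ctSentence fun H _ hH _ hHn =>
    realize_ctSentence.2 (hC H hH hHn)

end Universal

theorem countable_of_isFinitelyPresented (H : Type u) [Group H]
    (h : Group.IsFinitelyPresented H) : Countable H := by
  obtain ⟨n, f, hf, -⟩ := h
  exact hf.countable

end GroupClass

theorem corollary5p1 (C : ∀ (H : Type u) [Group H], Prop)
    (hfp : ∀ (H : Type u) [Group H], C H → Group.IsFinitelyPresented H)
    (hC : ∀ (H : Type u) [Group H], C H → GroupClass.Nonabelian H →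
      GroupClass.IsCSA H ∧ GroupClass.IsALC H ∧ GroupClass.IsBP H)
    (G : Type v) [Group G] (hG : GroupClass.Nonabelian G)
    (hres : GroupClass.IsResidually C G) (hALC : GroupClass.IsALC G)
    (hcenter : Subgroup.center G = ⊥) :
    List.TFAE
      [GroupClass.IsFullyResidually C G,
       GroupClass.IsCSA G,
       GroupClass.IsCT G,
       GroupClass.IsPC G,
       GroupClass.IsPT G,
       GroupClass.IsUniversally C G] := by
  have hCSA : ∀ (H : Type u) [Group H], C H → GroupClass.Nonabelian H → GroupClass.IsCSA H :=
    fun H _ hH hHn => (hC H hH hHn).1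
  have : Nontrivial G := by
    obtain ⟨x, y, hxy⟩ := hG
    exact ⟨x, 1, fun hx => hxy (hx ▸ Commute.one_left y)⟩
  tfae_have 1 → 2 := fun h => h.isCSA hCSA
  tfae_have 2 → 3 := fun h => h.isCT
  tfae_have 3 → 4 := fun h => h.isPC
  tfae_have 4 → 5 := fun h => h.isPT hALC
  tfae_have 5 → 3 := fun h => h.isCT hALC
  tfae_have 3 → 1 := fun h => h.isFullyResidually hCSA hres hcenter
  tfae_have 1 → 6 := fun h => h.isUniversally
    (fun H _ hH => GroupClass.countable_of_isFinitelyPresented H (hfp H hH)) hG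
  tfae_have 6 → 3 := fun h => h.isCT fun H _ hH hHn => (hCSA H hH hHn).isCT
  tfae_finish
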